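/- **Setting.** For $R\ge 0$ let $\mathcal L(R)$ be the set of probability distributions on $[0,\infty)$ with mean at most $R$. In the single-battlefield General Lotto game with favoritism $\text{GL-F}(p,R_A,R_B)$, $p\in\mathbb R$, players $A$ and $B$ simultaneously choose $F_A\in\mathcal L(R_A)$ and $F_B\in\mathcal L(R_B)$. Player $A$ gets $U_A=\mathbb P[x_A+p\ge x_B]$ for independent $x_A\sim F_A$, $x_B\sim F_B$, and player $B$ gets $U_B=1-U_A$. Let $\pi_A^*(p,R_A,R_B)$ be player $A$'s Nash equilibrium payoff. Let $c_A,c_B\in(0,1)$, $M_B\ge 0$, $p_A\in[0,M_A/c_A]$, and assume $R_A:=M_A-c_Ap_A>0$. For $p_B\in[0,M_B/c_B]$ put $R_B:=M_B-c_Bp_B$, $\mathbf p:=(p_A,p_B)$, and let player $B$'s payoff be $u_B(\mathbf p):=1-\pi_A^*(p_A-p_B,R_A,R_B)$. Define $$f_A:=R_A+\sqrt{R_A(R_A+2(p_A-p_B))},\quad f_B:=\sqrt{R_B},\quad g_B:=\sqrt{R_B+2(p_B-p_A)},$$ $$u_B^{1A}:=\frac{R_B}{2R_A}\Big(\frac{f_A}{p_A-p_B+f_A}\Big)^2,\qquad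 u_B^{2A}:=1-\frac{R_A}{2(R_B-(p_A-p_B))},$$ $$u_B^{1B}:=1-\frac{R_A}{2}\Big(\frac{f_B+g_B}{p_B-p_A+f_B(f_B+g_B)}\Big)^2,\qquad u_B^{2B}:=\frac{R_B}{2(R_A-(p_B-p_A))}.$$ **Lemma.** For fixed $(p_A,R_A)$ as above, the Nash equilibrium payoff of $\text{GL-F}(p_A-p_B,R_A,R_B)$ exists and is unique for every $p_B\in[0,M_B/c_B]$, and: a) If $\frac{M_B}{c_B}\le R_A+p_A$, then $u_B(\mathbf p)$ is decreasing (i.e. nonincreasing) in $p_B\in[0,\frac{M_B}{c_B}]$, and strictly decreasing if $\frac{M_B}{c_B}<R_A+p_A$. b) If $R_A+p_A<\frac{M_B}{c_B}\le\frac{R_A}{c_B}+p_A$, then $$u_B(\mathbf p)=\begin{cases}u_B^{1A}(\mathbf p),&p_B\in[0,p_A]\\u_B^{2B}(\mathbf p),&p_B\in(p_A,p_B^{1B}]\\u_B^{1B}(\mathbf p),&p_B\in(p_B^{1B},\frac{M_B}{c_B}]\end{cases}$$ where $p_B^{1B}$ is the unique solution in $[p_A,R_A+p_A)$ of $F(p_B):=\frac{2(R_A+p_A-p_B)^2}{2R_A+p_A-p_B}=M_B-c_Bp_B$.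 c) If $\frac{R_A}{c_B}+p_A<\frac{M_B}{c_B}\le\frac1{c_B}\Big(p_A+\frac{R_A+\sqrt{R_A(R_A+2p_A)}}2\Big)$, then $$u_B(\mathbf p)=\begin{cases}u_B^{1A}(\mathbf p),&p_B\in[0,p_B^{1A}]\\u_B^{2A}(\mathbf p),&p_B\in(p_B^{1A},p_A]\\u_B^{1B}(\mathbf p),&p_B\in(p_A,\frac{M_B}{c_B}]\end{cases}$$ where $p_B^{1A}$ is the unique solution of $G(p_B):=\frac{2(M_B+(1-c_B)p_B-p_A)^2}{2(M_B-c_Bp_B)-(p_A-p_B)}=R_A$ among the $p_B\in[0,p_A)$ with $M_B-c_Bp_B\ge p_A-p_B$. d) If $\frac{M_B}{c_B}>\frac1{c_B}\Big(p_A+\frac{R_A+\sqrt{R_A(R_A+2p_A)}}2\Big)$, then $$u_B(\mathbf p)=\begin{cases}u_B^{2A}(\mathbf p),&p_B\in[0,p_A]\\u_B^{1B}(\mathbf p),&p_B\in(p_A,\frac{M_B}{c_B}].\end{cases}$$ -/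

import Mathlib

open MeasureTheory Set
open scoped NNReal ENNReal

/-- Admissible (randomized) strategies on a single battlefield for a player with real-time
budget `R`: probability laws on `[0, ∞)` whose expected expenditure is at most `R`. -/
def LottoStrategies (R : ℝ) : Set (ProbabilityMeasure ℝ≥0) :=
  {F | ∫⁻ x, (x : ℝ≥0∞) ∂(F : Measure ℝ≥0) ≤ ENNReal.ofReal R}

/-- Expected payoff of player `A` on a battlefield of unit value, `p` being the (signed)
favoritism towards `A`: the probability that `x_A + p ≥ x_B`, for independent
`x_A ∼ F_A` and `x_B ∼ F_B`. -/
noncomputable def lottoPayoffA (p : ℝ) (FA FB : ProbabilityMeasure ℝ≥0) : ℝ :=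
  ((FA : Measure ℝ≥0).prod (FB : Measure ℝ≥0)).real
    {z : ℝ≥0 × ℝ≥0 | (z.1 : ℝ) + p ≥ (z.2 : ℝ)}

/-- Expected payoff of player `B`. -/
noncomputable def lottoPayoffB (p : ℝ) (FA FB : ProbabilityMeasure ℝ≥0) : ℝ :=
  1 - lottoPayoffA p FA FB

/-- Nash equilibria of the General Lotto game with favoritism `GL-F(p, R_A, R_B)`. -/
def IsLottoNash (p RA RB : ℝ) (FA FB : ProbabilityMeasure ℝ≥0) : Prop :=
  FA ∈ LottoStrategies RA ∧ FB ∈ LottoStrategies RB ∧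
    (∀ FA' ∈ LottoStrategies RA, lottoPayoffA p FA' FB ≤ lottoPayoffA p FA FB) ∧
    (∀ FB' ∈ LottoStrategies RB, lottoPayoffB p FA FB' ≤ lottoPayoffB p FA FB)

/-- The payoffs that player `A` obtains in the Nash equilibria of `GL-F(p, R_A, R_B)`. -/
def lottoNashPayoffsA (p RA RB : ℝ) : Set ℝ :=
  {v | ∃ FA FB : ProbabilityMeasure ℝ≥0, IsLottoNash p RA RB FA FB ∧ lottoPayoffA p FA FB = v}

/-- The equilibrium payoff `π_A^*(p, R_A, R_B)`: the element of `lottoNashPayoffsA p RA RB`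
whenever this set is a singleton. -/
noncomputable def lottoEqPayoffA (p RA RB : ℝ) : ℝ :=
  sSup (lottoNashPayoffsA p RA RB)

/-- Player `A`'s payoff `u_A(p_A, p_B)` in the Stackelberg game with monetary budgets
`MA, MB` and per-unit costs `cA, cB`. -/
noncomputable def stackPayoffA (MA cA MB cB pA pB : ℝ) : ℝ :=
  lottoEqPayoffA (pA - pB) (MA - cA * pA) (MB - cB * pB)

/-- Player `B`'s payoff `u_B(p_A, p_B)` in the Stackelberg game. -/
noncomputable def stackPayoffB (MA cA MB cB pA pB : ℝ) : ℝ :=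
  1 - stackPayoffA MA cA MB cB pA pB

/-- `f_A(p) = R_A + √(R_A (R_A + 2 (p_A - p_B)))`. -/
noncomputable def fA (RA pA pB : ℝ) : ℝ :=
  RA + √(RA * (RA + 2 * (pA - pB)))

/-- `f_B(p) = √R_B`, where `R_B = M_B - c_B p_B`. -/
noncomputable def fB (MB cB pB : ℝ) : ℝ :=
  √(MB - cB * pB)

/-- `g_B(p) = √(R_B + 2 (p_B - p_A))`, where `R_B = M_B - c_B p_B`. -/
noncomputable def gB (MB cB pA pB : ℝ) : ℝ :=
  √(MB - cB * pB + 2 * (pB - pA))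

/-- The formula `u_B^{1A}`. -/
noncomputable def uB1A (RA MB cB pA pB : ℝ) : ℝ :=
  (MB - cB * pB) / (2 * RA) * (fA RA pA pB / (pA - pB + fA RA pA pB)) ^ 2

/-- The formula `u_B^{2A}`. -/
noncomputable def uB2A (RA MB cB pA pB : ℝ) : ℝ :=
  1 - RA / (2 * (MB - cB * pB - (pA - pB)))

/-- The formula `u_B^{1B}`. -/
noncomputable def uB1B (RA MB cB pA pB : ℝ) : ℝ :=
  1 - RA / 2 * ((fB MB cB pB + gB MB cB pA pB) /
    (pB - pA + fB MB cB pB * (fB MB cB pB + gB MB cB pA pB))) ^ 2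

/-- The formula `u_B^{2B}`. -/
noncomputable def uB2B (RA MB cB pA pB : ℝ) : ℝ :=
  (MB - cB * pB) / (2 * (RA - (pB - pA)))

/-- The function `F` of `p_B`; the breakpoint `p_B^{1B}` solves `F(p_B) = M_B - c_B p_B`. -/
noncomputable def breakF (RA pA pB : ℝ) : ℝ :=
  2 * (RA + pA - pB) ^ 2 / (2 * RA + pA - pB)

/-- The function `G` of `p_B`; the breakpoint `p_B^{1A}` solves `G(p_B) = R_A`. -/
noncomputable def breakG (MB cB pA pB : ℝ) : ℝ :=
  2 * (MB + (1 - cB) * pB - pA) ^ 2 / (2 * (MB - cB * pB) - (pA - pB))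

/-- `q` is the unique element of the set `S` that satisfies `P`. -/
def IsUniqueSolOn (S : Set ℝ) (P : ℝ → Prop) (q : ℝ) : Prop :=
  q ∈ S ∧ P q ∧ ∀ q' ∈ S, P q' → q' = q

/-! The game is constant-sum, so one pair of optimal strategies determines every equilibrium payoff.
Such a pair can be written down: each player mixes a point mass at `0` with a uniform law of width
`k`, starting at `0` for the player with the head start and at the size of the head start for the
opponent. Against such a law the winning probability is bounded by an affine function of one's own
bid, so only the mean of the bids matters, and the two resulting bounds meet.

There are two regimes on each side of `pB = pA`. Either the disadvantaged player sometimes concedes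
by bidding `0`, and `k` is then `headRoot`, the positive root of `h ^ 2 = 2 * R * (h + p)` for the
advantaged player's budget `R`; or that player never concedes, and the budget fixes `k`. The regime
boundary compares the disadvantaged budget with `p + headRoot p R / 2`. Parts b) to d) locate `pB`
relative to that boundary, for which `breakF` and `breakG` are rational forms.

Part a) compares the values at two points `pB`. Below `pA` both have a closed form and the claim is
an inequality between two roots. Above `pA` a suboptimal strategy of `A` at the later point already
secures at least the earlier value, so the later regime need not be known. -/

/-! ### Values of the constant-sum game -/

/-- The number `v` is the value of `GL-F(p, R_A, R_B)`, attained by a pair of optimal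
strategies. -/
def HasLottoValue (p RA RB v : ℝ) : Prop :=
  ∃ FA ∈ LottoStrategies RA, ∃ FB ∈ LottoStrategies RB,
    (∀ FB' ∈ LottoStrategies RB, v ≤ lottoPayoffA p FA FB') ∧
    (∀ FA' ∈ LottoStrategies RA, lottoPayoffA p FA' FB ≤ v)

/-- At an equilibrium, deviating to an optimal strategy cannot help either player; since the payoffs
sum to one, this squeezes the equilibrium payoff to `v` from both sides. -/
theorem HasLottoValue.nashPayoffs_eq {p RA RB v : ℝ} (h : HasLottoValue p RA RB v) :
    lottoNashPayoffsA p RA RB = {v} := by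
  obtain ⟨FA, hFA, FB, hFB, hA, hB⟩ := h
  ext w
  simp only [lottoNashPayoffsA, mem_ofPred_eq, mem_singleton_iff]
  constructor
  · rintro ⟨GA, GB, ⟨hGA, hGB, h1, h2⟩, rfl⟩
    refine le_antisymm ?_ ?_
    · have := h2 FB hFB
      simp only [lottoPayoffB] at this
      linarith [hB GA hGA]
    · exact (hA GB hGB).trans (h1 FA hFA)
  · rintro rfl
    have hv : lottoPayoffA p FA FB = w := le_antisymm (hB FA hFA) (hA FB hFB)
    refine ⟨FA, FB, ⟨hFA, hFB, fun GA hGA => hv ▸ hB GA hGA, fun GB hGB => ?_⟩, hv⟩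
    simp only [lottoPayoffB]
    linarith [hA GB hGB]

theorem HasLottoValue.eqPayoff_eq {p RA RB v : ℝ} (h : HasLottoValue p RA RB v) :
    lottoEqPayoffA p RA RB = v := by
  rw [lottoEqPayoffA, h.nashPayoffs_eq, csSup_singleton]

theorem HasLottoValue.le_of_forall {p RA RB v w : ℝ} (h : HasLottoValue p RA RB v)
    {FA : ProbabilityMeasure ℝ≥0} (hFA : FA ∈ LottoStrategies RA)
    (hw : ∀ FB ∈ LottoStrategies RB, w ≤ lottoPayoffA p FA FB) : w ≤ v := by
  obtain ⟨-, -, FB, hFB, -, hB⟩ := h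
  exact (hw FB hFB).trans (hB FA hFA)

/-! ### Payoffs as integrals and affine bounds -/

section Expectation

variable {R : ℝ} {F : ProbabilityMeasure ℝ≥0}

theorem integrable_coe_of_mem_lottoStrategies (hF : F ∈ LottoStrategies R) :
    Integrable (fun x : ℝ≥0 => (x : ℝ)) (F : Measure ℝ≥0) := by
  refine ⟨by fun_prop, ?_⟩
  rw [hasFiniteIntegral_iff_ofReal (Filter.Eventually.of_forall fun x => x.2)]
  simp only [ENNReal.ofReal_coe_nnreal]
  exact lt_of_le_of_lt hF ENNReal.ofReal_lt_top

theorem integral_coe_le_of_mem_lottoStrategies (hR : 0 ≤ R) (hF : F ∈ LottoStrategies R) :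
    ∫ x : ℝ≥0, (x : ℝ) ∂(F : Measure ℝ≥0) ≤ R := by
  rw [integral_eq_lintegral_of_nonneg_ae (Filter.Eventually.of_forall fun x => x.2)
    (by fun_prop)]
  simp only [ENNReal.ofReal_coe_nnreal]
  exact ENNReal.toReal_le_of_le_ofReal hR hF

theorem ae_eq_zero_of_mem_lottoStrategies_zero (hF : F ∈ LottoStrategies 0) :
    ∀ᵐ x ∂(F : Measure ℝ≥0), x = 0 := by
  have h : ∫⁻ x, (x : ℝ≥0∞) ∂(F : Measure ℝ≥0) = 0 := by
    have h : ∫⁻ x, (x : ℝ≥0∞) ∂(F : Measure ℝ≥0) ≤ ENNReal.ofReal 0 := hF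
    simpa using h
  rw [lintegral_eq_zero_iff (by fun_prop)] at h
  filter_upwards [h] with x hx
  simpa using hx

end Expectation

theorem measurableSet_lottoWin (p : ℝ) :
    MeasurableSet {z : ℝ≥0 × ℝ≥0 | (z.1 : ℝ) + p ≥ (z.2 : ℝ)} :=
  measurableSet_le (by fun_prop) (by fun_prop)

theorem lottoPayoffA_eq_integral_left (p : ℝ) (FA FB : ProbabilityMeasure ℝ≥0) :
    Integrable (fun x : ℝ≥0 => (FB : Measure ℝ≥0).real {y | (y : ℝ) ≤ x + p}) FA ∧
    lottoPayoffA p FA FB =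
      ∫ x : ℝ≥0, (FB : Measure ℝ≥0).real {y | (y : ℝ) ≤ x + p} ∂(FA : Measure ℝ≥0) := by
  have hs := measurableSet_lottoWin p
  have hm : Measurable fun x : ℝ≥0 => (FB : Measure ℝ≥0) {y | (y : ℝ) ≤ x + p} :=
    measurable_measure_prodMk_left hs
  constructor
  · refine Integrable.of_bound (C := 1) hm.ennreal_toReal.aestronglyMeasurable ?_
    refine Filter.Eventually.of_forall fun x => ?_
    rw [Real.norm_of_nonneg measureReal_nonneg]
    exact measureReal_le_one
  · rw [lottoPayoffA, measureReal_def, Measure.prod_apply hs]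
    exact (integral_toReal hm.aemeasurable
      (Filter.Eventually.of_forall fun x => measure_lt_top _ _)).symm

theorem lottoPayoffA_eq_integral_right (p : ℝ) (FA FB : ProbabilityMeasure ℝ≥0) :
    Integrable (fun y : ℝ≥0 => (FA : Measure ℝ≥0).real {x | (y : ℝ) - p ≤ x}) FB ∧
    lottoPayoffA p FA FB =
      ∫ y : ℝ≥0, (FA : Measure ℝ≥0).real {x | (y : ℝ) - p ≤ x} ∂(FB : Measure ℝ≥0) := by
  have hs := measurableSet_lottoWin p
  have he : ∀ y : ℝ≥0, {x : ℝ≥0 | (y : ℝ) - p ≤ x} =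
      (fun x => (x, y)) ⁻¹' {z : ℝ≥0 × ℝ≥0 | (z.1 : ℝ) + p ≥ (z.2 : ℝ)} := by
    intro y; ext x; simp
  have hm : Measurable fun y : ℝ≥0 => (FA : Measure ℝ≥0) {x | (y : ℝ) - p ≤ x} := by
    simp only [he]
    exact measurable_measure_prodMk_right hs
  constructor
  · refine Integrable.of_bound (C := 1) hm.ennreal_toReal.aestronglyMeasurable ?_
    refine Filter.Eventually.of_forall fun x => ?_
    rw [Real.norm_of_nonneg measureReal_nonneg]
    exact measureReal_le_one
  · rw [lottoPayoffA, measureReal_def, Measure.prod_apply_symm hs]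
    simp only [← he]
    exact (integral_toReal hm.aemeasurable
      (Filter.Eventually.of_forall fun x => measure_lt_top _ _)).symm

/-- The slope `l` acts as a Lagrange multiplier for the budget: integrating the affine majorant
leaves only the mean, and `l ≥ 0` turns the mean into `RA`. -/
theorem lottoPayoffA_le_of_affine {p RA c l : ℝ} {FA FB : ProbabilityMeasure ℝ≥0}
    (hRA : 0 ≤ RA) (hl : 0 ≤ l) (hFA : FA ∈ LottoStrategies RA)
    (h : ∀ x : ℝ≥0, (FB : Measure ℝ≥0).real {y | (y : ℝ) ≤ x + p} ≤ c + l * x) :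
    lottoPayoffA p FA FB ≤ c + l * RA := by
  obtain ⟨hi, he⟩ := lottoPayoffA_eq_integral_left p FA FB
  have hx := integrable_coe_of_mem_lottoStrategies hFA
  calc lottoPayoffA p FA FB ≤ ∫ x : ℝ≥0, (c + l * x) ∂(FA : Measure ℝ≥0) := by
        rw [he]
        exact integral_mono hi ((integrable_const c).add (hx.const_mul l)) h
    _ = c + l * ∫ x : ℝ≥0, (x : ℝ) ∂(FA : Measure ℝ≥0) := by
        rw [integral_add (integrable_const c) (hx.const_mul l), integral_const_mul]
        simp
    _ ≤ c + l * RA := by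
        gcongr
        exact integral_coe_le_of_mem_lottoStrategies hRA hFA

/-- Dual of the upper bound. The minorant is required only almost everywhere, so that it can be used
for a `B` without budget, who bids `0` almost surely. -/
theorem le_lottoPayoffA_of_affine {p RB c l : ℝ} {FA FB : ProbabilityMeasure ℝ≥0}
    (hRB : 0 ≤ RB) (hl : 0 ≤ l) (hFB : FB ∈ LottoStrategies RB)
    (h : ∀ᵐ y : ℝ≥0 ∂(FB : Measure ℝ≥0),
      c - l * y ≤ (FA : Measure ℝ≥0).real {x | (y : ℝ) - p ≤ x}) :
    c - l * RB ≤ lottoPayoffA p FA FB := by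
  obtain ⟨hi, he⟩ := lottoPayoffA_eq_integral_right p FA FB
  have hx := integrable_coe_of_mem_lottoStrategies hFB
  calc c - l * RB ≤ c - l * ∫ x : ℝ≥0, (x : ℝ) ∂(FB : Measure ℝ≥0) := by
        gcongr
        exact integral_coe_le_of_mem_lottoStrategies hRB hFB
    _ = ∫ x : ℝ≥0, (c - l * x) ∂(FB : Measure ℝ≥0) := by
        rw [integral_sub (integrable_const c) (hx.const_mul l), integral_const_mul]
        simp
    _ ≤ lottoPayoffA p FA FB := by
        rw [he]
        exact integral_mono_ae ((integrable_const c).sub (hx.const_mul l)) hi h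

/-! ### Mixtures of an atom at zero and a uniform law -/

section Mix

/-- The mixture of the point mass at `0` (with weight `1 - b`) and of the uniform
distribution on `[a, a + k]` (with weight `b`). -/
noncomputable def lottoMixMeasure (b a k : ℝ) : Measure ℝ≥0 :=
  ENNReal.ofReal (1 - b) • Measure.dirac 0 +
    ENNReal.ofReal b • (volume.restrict (Icc (0 : ℝ) 1)).map fun u => (a + k * u).toNNReal

variable {b a k : ℝ}

theorem measurable_mixMap (a k : ℝ) : Measurable fun u : ℝ => (a + k * u).toNNReal := by
  fun_prop

theorem isProbabilityMeasure_lottoMixMeasure (a k : ℝ) (hb0 : 0 ≤ b) (hb1 : b ≤ 1) :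
    IsProbabilityMeasure (lottoMixMeasure b a k) := by
  constructor
  simp only [lottoMixMeasure, Measure.coe_add, Measure.coe_smul, Pi.add_apply, Pi.smul_apply,
    smul_eq_mul, measure_univ, Measure.map_apply (measurable_mixMap a k) MeasurableSet.univ]
  simp [← ENNReal.ofReal_add (sub_nonneg.2 hb1) hb0]

/-- The mixture `lottoMixMeasure` as a probability law. -/
noncomputable def lottoMix (b a k : ℝ) (hb : b ∈ Icc (0 : ℝ) 1) : ProbabilityMeasure ℝ≥0 :=
  ⟨lottoMixMeasure b a k, isProbabilityMeasure_lottoMixMeasure a k hb.1 hb.2⟩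

theorem lottoMix_mem {R : ℝ} (hb : b ∈ Icc (0 : ℝ) 1) (ha : 0 ≤ a) (hk : 0 ≤ k)
    (hR : b * (a + k / 2) ≤ R) : lottoMix b a k hb ∈ LottoStrategies R := by
  have hu : ∫⁻ u in Icc (0 : ℝ) 1, ENNReal.ofReal (a + k * u) = ENNReal.ofReal (a + k / 2) := by
    rw [← ofReal_integral_eq_lintegral_ofReal]
    · rw [integral_Icc_eq_integral_Ioc, ← intervalIntegral.integral_of_le zero_le_one]
      congr 1
      rw [intervalIntegral.integral_add (by simp)
        (by apply Continuous.intervalIntegrable; fun_prop),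
        intervalIntegral.integral_const_mul, integral_id]
      simp; ring
    · exact (by fun_prop : Continuous fun u : ℝ => a + k * u).integrableOn_Icc
    · filter_upwards [ae_restrict_mem measurableSet_Icc] with u hu
      have := mul_nonneg hk hu.1
      simp only [Pi.zero_apply]; linarith
  have : ∫⁻ x, (x : ℝ≥0∞) ∂(lottoMixMeasure b a k) = ENNReal.ofReal (b * (a + k / 2)) := by
    rw [lottoMixMeasure, lintegral_add_measure, lintegral_smul_measure, lintegral_smul_measure,
      lintegral_dirac, lintegral_map (by fun_prop) (measurable_mixMap a k),
      ENNReal.ofReal_mul hb.1, ← hu]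
    simp [ENNReal.ofReal]
  simp only [LottoStrategies, mem_ofPred_eq]
  change ∫⁻ x, (x : ℝ≥0∞) ∂(lottoMixMeasure b a k) ≤ _
  rw [this]
  exact ENNReal.ofReal_le_ofReal hR

theorem lottoMix_real_apply (hb : b ∈ Icc (0 : ℝ) 1) {s : Set ℝ≥0} (hs : MeasurableSet s) :
    (lottoMix b a k hb : Measure ℝ≥0).real s =
      (1 - b) * s.indicator 1 0 +
        b * volume.real ((fun u : ℝ => (a + k * u).toNNReal) ⁻¹' s ∩ Icc 0 1) := by
  change (lottoMixMeasure b a k).real s = _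
  have hfin : ∀ t : Set ℝ, volume (t ∩ Icc 0 1) ≠ ⊤ := fun t =>
    ((measure_mono inter_subset_right).trans_lt (by simp)).ne
  rw [lottoMixMeasure, measureReal_def, Measure.add_apply, Measure.smul_apply,
    Measure.smul_apply, Measure.map_apply (measurable_mixMap a k) hs,
    Measure.restrict_apply (measurable_mixMap a k hs), Measure.dirac_apply' _ hs,
    ENNReal.toReal_add, smul_eq_mul, smul_eq_mul, ENNReal.toReal_mul, ENNReal.toReal_mul,
    ENNReal.toReal_ofReal (sub_nonneg.2 hb.2), ENNReal.toReal_ofReal hb.1, measureReal_def]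
  · congr 2
    by_cases h : (0 : ℝ≥0) ∈ s <;> simp [h]
  · by_cases h : (0 : ℝ≥0) ∈ s <;> simp [h]
  · exact ENNReal.mul_ne_top ENNReal.ofReal_ne_top (hfin _)

theorem measurableSet_coe_le (z : ℝ) : MeasurableSet {y : ℝ≥0 | (y : ℝ) ≤ z} :=
  measurableSet_le (by fun_prop) (by fun_prop)

theorem measurableSet_le_coe (z : ℝ) : MeasurableSet {y : ℝ≥0 | z ≤ (y : ℝ)} :=
  measurableSet_le (by fun_prop) (by fun_prop)

theorem lottoMix_real_Iic_of_neg (hb : b ∈ Icc (0 : ℝ) 1) {z : ℝ} (hz : z < 0) :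
    (lottoMix b a k hb : Measure ℝ≥0).real {y | (y : ℝ) ≤ z} = 0 := by
  have : {y : ℝ≥0 | (y : ℝ) ≤ z} = ∅ := by
    ext y
    simpa using lt_of_lt_of_le hz y.2
  simp [this]

theorem lottoMix_real_Ici_of_nonpos (hb : b ∈ Icc (0 : ℝ) 1) {z : ℝ} (hz : z ≤ 0) :
    (lottoMix b a k hb : Measure ℝ≥0).real {y | z ≤ (y : ℝ)} = 1 := by
  have : {y : ℝ≥0 | z ≤ (y : ℝ)} = univ := by
    ext y
    simpa using hz.trans y.2
  simp [this]

theorem lottoMix_real_Iic_le (hb : b ∈ Icc (0 : ℝ) 1) (ha : 0 ≤ a) (hk : 0 < k) {z : ℝ}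
    (hz : a ≤ z) :
    (lottoMix b a k hb : Measure ℝ≥0).real {y | (y : ℝ) ≤ z} ≤
      1 - b + b * ((z - a) / k) := by
  rw [lottoMix_real_apply hb (measurableSet_coe_le z)]
  have h0 : 0 ≤ (z - a) / k := div_nonneg (by linarith) hk.le
  have hsub : (fun u : ℝ => (a + k * u).toNNReal) ⁻¹' {y | (y : ℝ) ≤ z} ∩ Icc 0 1 ⊆
      Icc 0 ((z - a) / k) := by
    rintro u ⟨hu, hu0, -⟩
    refine ⟨hu0, ?_⟩
    have hu' : ((a + k * u).toNNReal : ℝ) ≤ z := hu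
    rw [Real.coe_toNNReal _ (by positivity)] at hu'
    rw [le_div_iff₀ hk]
    linarith
  have hv := measureReal_mono (μ := volume) hsub (by simp)
  rw [Real.volume_real_Icc_of_le h0, sub_zero] at hv
  have hi : ({y : ℝ≥0 | (y : ℝ) ≤ z}.indicator 1 0 : ℝ) = 1 := by
    exact indicator_of_mem (s := {y : ℝ≥0 | (y : ℝ) ≤ z})
      (show ((0 : ℝ≥0) : ℝ) ≤ z by simpa using ha.trans hz) _
  rw [hi, mul_one]
  gcongr
  exact hb.1

theorem le_lottoMix_real_Ici (hb : b ∈ Icc (0 : ℝ) 1) (hk : 0 < k) {z : ℝ}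
    (hz : a ≤ z) :
    b * (1 - (z - a) / k) ≤ (lottoMix b a k hb : Measure ℝ≥0).real {y | z ≤ (y : ℝ)} := by
  rw [lottoMix_real_apply hb (measurableSet_le_coe z)]
  have h0 : 0 ≤ (z - a) / k := div_nonneg (by linarith) hk.le
  have hsub : Icc ((z - a) / k) 1 ⊆
      (fun u : ℝ => (a + k * u).toNNReal) ⁻¹' {y | z ≤ (y : ℝ)} ∩ Icc 0 1 := by
    rintro u ⟨hu, hu1⟩
    refine ⟨?_, h0.trans hu, hu1⟩
    change z ≤ ((a + k * u).toNNReal : ℝ)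
    rw [div_le_iff₀ hk] at hu
    refine le_trans ?_ (Real.le_coe_toNNReal _)
    linarith
  have hv := measureReal_mono (μ := volume) hsub
    ((measure_mono inter_subset_right).trans_lt (by simp)).ne
  rw [Real.volume_real_Icc] at hv
  have hi : 0 ≤ (1 - b) * ({y : ℝ≥0 | z ≤ (y : ℝ)}.indicator 1 0 : ℝ) :=
    mul_nonneg (sub_nonneg.2 hb.2) (indicator_nonneg (by simp) _)
  have := mul_le_mul_of_nonneg_left ((le_max_left _ _).trans hv) hb.1
  linarith

theorem le_lottoMix_real_Ici_left (hb : b ∈ Icc (0 : ℝ) 1) (hk : 0 ≤ k) :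
    b ≤ (lottoMix b a k hb : Measure ℝ≥0).real {y | a ≤ (y : ℝ)} := by
  rw [lottoMix_real_apply hb (measurableSet_le_coe a)]
  have hsub : (fun u : ℝ => (a + k * u).toNNReal) ⁻¹' {y | a ≤ (y : ℝ)} ∩ Icc 0 1 = Icc 0 1 := by
    refine inter_eq_right.2 fun u hu => ?_
    refine le_trans ?_ (Real.le_coe_toNNReal _)
    linarith [mul_nonneg hk hu.1]
  have hi : 0 ≤ (1 - b) * ({y : ℝ≥0 | a ≤ (y : ℝ)}.indicator 1 0 : ℝ) :=
    mul_nonneg (sub_nonneg.2 hb.2) (indicator_nonneg (by simp) _)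
  rw [hsub]
  simpa using hi

end Mix

/-! ### Values from explicit optimal pairs -/

/-- The player with the head start `p ≥ 0` is `A`. -/
theorem hasLottoValue_of_headStart_A {p RA RB k bA bB : ℝ} (hp : 0 ≤ p) (hk : 0 < k)
    (hRA : 0 ≤ RA) (hRB : 0 ≤ RB) (hbA : bA ∈ Icc (0 : ℝ) 1) (hbB : bB ∈ Icc (0 : ℝ) 1)
    (hA : bA * (k / 2) ≤ RA) (hB : bB * (p + k / 2) ≤ RB) (hc : 0 ≤ 1 - bA - bA / k * p)
    (hv : 1 - bA - bA / k * p + bA / k * RB = bB * (1 - RA / k)) :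
    HasLottoValue p RA RB (1 - bB * (1 - RA / k)) := by
  have hlA : 0 ≤ bA / k := div_nonneg hbA.1 hk.le
  have hlB : 0 ≤ bB / k := div_nonneg hbB.1 hk.le
  refine ⟨lottoMix bA 0 k hbA, lottoMix_mem hbA le_rfl hk.le (by simpa using hA),
    lottoMix bB p k hbB, lottoMix_mem hbB hp hk.le hB, fun FB hFB => ?_, fun FA hFA => ?_⟩
  · have : 1 - bB * (1 - RA / k) = (bA + bA / k * p) - bA / k * RB := by linarith
    rw [this]
    refine le_lottoPayoffA_of_affine hRB hlA hFB (Filter.Eventually.of_forall fun y => ?_)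
    -- A bid `y ≤ p` never beats the head start, and there `hc` keeps the affine minorant below `1`.
    rcases le_total ((y : ℝ) - p) 0 with h | h
    · rw [lottoMix_real_Ici_of_nonpos hbA h]
      have := mul_nonneg hlA y.coe_nonneg
      linarith
    · refine le_trans (le_of_eq ?_) (le_lottoMix_real_Ici hbA hk h)
      field_simp
      ring
  · have : 1 - bB * (1 - RA / k) = (1 - bB) + bB / k * RA := by ring
    rw [this]
    refine lottoPayoffA_le_of_affine hRA hlB hFA fun x => ?_
    refine (lottoMix_real_Iic_le hbB hp hk (by linarith [x.coe_nonneg])).trans (le_of_eq ?_)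
    field_simp
    ring

/-- The payoff that `A` secures by staking uniformly on `[q, q + k]` with probability `b`,
when `B` has the head start `q ≥ 0`. -/
theorem le_payoff_lottoMix_of_headStart_B {q RB k b : ℝ} (hk : 0 < k)
    (hRB : 0 ≤ RB) (hb : b ∈ Icc (0 : ℝ) 1) {FB : ProbabilityMeasure ℝ≥0}
    (hFB : FB ∈ LottoStrategies RB) :
    b * (1 - RB / k) ≤ lottoPayoffA (-q) (lottoMix b q k hb) FB := by
  have : b * (1 - RB / k) = b - b / k * RB := by ring
  rw [this]
  refine le_lottoPayoffA_of_affine hRB (div_nonneg hb.1 hk.le) hFB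
    (Filter.Eventually.of_forall fun y => ?_)
  refine le_trans (le_of_eq ?_) (le_lottoMix_real_Ici hb hk (by linarith [y.coe_nonneg]))
  field_simp
  ring

/-- The player with the head start `q ≥ 0` is `B`. -/
theorem hasLottoValue_of_headStart_B {q RA RB k bA bB : ℝ} (hq : 0 ≤ q) (hk : 0 < k)
    (hRA : 0 ≤ RA) (hRB : 0 ≤ RB) (hbA : bA ∈ Icc (0 : ℝ) 1) (hbB : bB ∈ Icc (0 : ℝ) 1)
    (hA : bA * (q + k / 2) ≤ RA) (hB : bB * (k / 2) ≤ RB) (hc : 0 ≤ 1 - bB - bB / k * q)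
    (hv : 1 - bB - bB / k * q + bB / k * RA = bA * (1 - RB / k)) :
    HasLottoValue (-q) RA RB (bA * (1 - RB / k)) := by
  have hlB : 0 ≤ bB / k := div_nonneg hbB.1 hk.le
  refine ⟨lottoMix bA q k hbA, lottoMix_mem hbA hq hk.le hA, lottoMix bB 0 k hbB,
    lottoMix_mem hbB le_rfl hk.le (by simpa using hB),
    fun FB hFB => le_payoff_lottoMix_of_headStart_B hk hRB hbA hFB, fun FA hFA => ?_⟩
  rw [← hv]
  refine lottoPayoffA_le_of_affine hRA hlB hFA fun x => ?_
  -- A bid `x < q` always loses, and there `hc` keeps the affine majorant nonnegative.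
  rcases lt_or_ge ((x : ℝ) + -q) 0 with h | h
  · rw [lottoMix_real_Iic_of_neg hbB h]
    have := mul_nonneg hlB x.coe_nonneg
    linarith
  · refine (lottoMix_real_Iic_le hbB le_rfl hk h).trans (le_of_eq ?_)
    field_simp
    ring

/-- This covers the degenerate width `k = 0`. Ties go to `A`, so bidding exactly `q` beats `0`. The
upper bound is trivial for `b = 1`; otherwise it is Markov's inequality, since `A` wins against `0`
only with a bid of at least `q`. -/
theorem hasLottoValue_zero_budget {q RA b : ℝ} (hq : 0 ≤ q) (hRA : 0 ≤ RA)
    (hb : b ∈ Icc (0 : ℝ) 1) (hA : b * q ≤ RA)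
    (hv : b = 1 ∨ 0 < q ∧ b = RA / q) : HasLottoValue (-q) RA 0 b := by
  have h0 : (0 : ℝ) ∈ Icc (0 : ℝ) 1 := by simp
  refine ⟨lottoMix b q 0 hb, lottoMix_mem hb hq le_rfl (by simpa using hA),
    lottoMix 0 0 0 h0, lottoMix_mem h0 le_rfl le_rfl (by simp), fun FB hFB => ?_,
    fun FA hFA => ?_⟩
  · have := le_lottoPayoffA_of_affine (p := -q) (c := b) (l := 0) (FA := lottoMix b q 0 hb)
      le_rfl le_rfl hFB ?_
    · simpa using this
    · filter_upwards [ae_eq_zero_of_mem_lottoStrategies_zero hFB] with y hy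
      simpa [hy] using le_lottoMix_real_Ici_left (a := q) hb le_rfl
  · rcases hv with rfl | ⟨hq0, rfl⟩
    · exact measureReal_le_one
    · have : RA / q = 0 + 1 / q * RA := by ring
      rw [this]
      refine lottoPayoffA_le_of_affine hRA (by positivity) hFA fun x => ?_
      rcases lt_or_ge ((x : ℝ) + -q) 0 with h | h
      · rw [lottoMix_real_Iic_of_neg h0 h]
        have := x.coe_nonneg
        positivity
      · refine measureReal_le_one.trans ?_
        rw [zero_add, one_div, inv_mul_eq_div, le_div_iff₀ hq0]
        linarith

/-- The positive root `h` of `h ^ 2 = 2 * R * (h + p)`. -/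
noncomputable def headRoot (p R : ℝ) : ℝ := R + √(R * (R + 2 * p))

section HeadRoot

variable {p R x : ℝ}

theorem headRoot_sq (hp : 0 ≤ p) (hR : 0 ≤ R) :
    headRoot p R ^ 2 = 2 * R * (headRoot p R + p) := by
  have := Real.sq_sqrt (by positivity : 0 ≤ R * (R + 2 * p))
  simp only [headRoot]
  nlinarith

theorem two_mul_le_headRoot (hp : 0 ≤ p) (hR : 0 ≤ R) : 2 * R ≤ headRoot p R := by
  have : R ≤ √(R * (R + 2 * p)) := Real.le_sqrt_of_sq_le (by nlinarith [mul_nonneg hR hp])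
  simp only [headRoot]
  linarith

theorem le_headRoot_iff (hp : 0 ≤ p) (hR : 0 ≤ R) (hx : 0 ≤ x) :
    x ≤ headRoot p R ↔ x ^ 2 ≤ 2 * R * (x + p) := by
  have hh : x ≤ headRoot p R ↔ x - R ≤ √(R * (R + 2 * p)) := by
    simp only [headRoot]
    constructor <;> intro <;> linarith
  rw [hh]
  constructor
  · intro h
    rcases le_total R x with hRx | hRx
    · rw [Real.le_sqrt (by linarith) (by positivity)] at h
      nlinarith
    · nlinarith [mul_nonneg hR hp, mul_nonneg hx hR, mul_nonneg hx (sub_nonneg.2 hRx)]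
  · intro h
    exact Real.le_sqrt_of_sq_le (by nlinarith)

end HeadRoot

/-! ### The four regimes -/

/-- Here `B` concedes with probability `1 - bB`, so `B` must be indifferent between `0` and a bid in
`[p, p + k]`: this makes `hc` an equality and forces `bA = k / (p + k)`. Exhausting `A`'s budget is
then the equation of `headRoot`. -/
theorem hasLottoValue_uniform_A {p RA RB : ℝ} (hp : 0 ≤ p) (hRA : 0 < RA) (hRB : 0 ≤ RB)
    (h : RB ≤ p + headRoot p RA / 2) :
    HasLottoValue p RA RB (1 - RB / (p + headRoot p RA)) := by
  have hsq := headRoot_sq hp hRA.le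
  have h2 := two_mul_le_headRoot hp hRA.le
  set k := headRoot p RA
  have hk : 0 < k := by linarith
  have hv : RB / (p + k / 2) * (1 - RA / k) = RB / (p + k) := by
    have : RA = k ^ 2 / (2 * (k + p)) := by rw [hsq]; field_simp
    rw [this]
    field_simp
    ring
  rw [← hv]
  have e1 : k / (p + k) / k * p = p / (p + k) := by field_simp
  have e2 : 1 - k / (p + k) - p / (p + k) = 0 := by field_simp; ring
  refine hasLottoValue_of_headStart_A (bA := k / (p + k)) hp hk hRA.le hRB
    ⟨by positivity, ?_⟩ ⟨by positivity, ?_⟩ ?_ ?_ ?_ ?_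
  · rw [div_le_one (by positivity)]; linarith
  · rw [div_le_one (by positivity)]; linarith
  · rw [div_mul_eq_mul_div, div_le_iff₀ (by positivity)]; nlinarith
  · rw [div_mul_cancel₀ _ (by positivity)]
  · rw [e1, e2]
  · rw [e1, e2, hv]; field_simp; ring

/-- Here `B` never concedes: `bB = 1`, the budget gives `k = 2 * (RB - p)`, and `hc` may be slack.
Its nonnegativity is exactly the quadratic inequality saying that `k` is at least `headRoot p RA`.
-/
theorem hasLottoValue_uniform_B {p RA RB : ℝ} (hp : 0 ≤ p) (hRA : 0 < RA)
    (h : p + headRoot p RA / 2 ≤ RB) :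
    HasLottoValue p RA RB (RA / (2 * (RB - p))) := by
  have h2 := two_mul_le_headRoot hp hRA.le
  obtain ⟨y, hy⟩ : ∃ y, y = RB - p := ⟨_, rfl⟩
  have hRy : RA ≤ y := by linarith
  have hy0 : 0 < y := by linarith
  have hRB : RB = y + p := by linarith
  have hq : 2 * RA * (2 * y + p) ≤ (2 * y) ^ 2 := by
    have hsq := headRoot_sq hp hRA.le
    have : headRoot p RA ≤ 2 * y := by linarith
    nlinarith
  rw [← hy, hRB]
  have hv : RA / (2 * y) = 1 - 1 * (1 - RA / (2 * y)) := by ring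
  have e1 : 1 - RA / y - RA / y / (2 * y) * p =
      ((2 * y) ^ 2 - 2 * RA * (2 * y + p)) / (2 * y) ^ 2 := by
    field_simp; ring
  rw [hv]
  refine hasLottoValue_of_headStart_A (bA := RA / y) hp (by positivity) hRA.le (by positivity)
    ⟨by positivity, ?_⟩ ⟨by simp, le_rfl⟩ ?_ ?_ ?_ ?_
  · rwa [div_le_one hy0]
  · apply le_of_eq; field_simp
  · apply le_of_eq; ring
  · rw [e1]; exact div_nonneg (by linarith) (by positivity)
  · field_simp; ring

theorem hasLottoValue_uniform_B_of_headStart_B {q RA RB : ℝ} (hq : 0 ≤ q) (hRA : 0 < RA)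
    (hRB : 0 ≤ RB) (h : RA ≤ q + headRoot q RB / 2) :
    HasLottoValue (-q) RA RB (RA / (q + headRoot q RB)) := by
  rcases hRB.eq_or_lt with rfl | hRB
  · simp only [headRoot, zero_mul, Real.sqrt_zero, add_zero, zero_div] at h ⊢
    have hq0 : 0 < q := hRA.trans_le h
    exact hasLottoValue_zero_budget hq hRA.le ⟨by positivity, by rwa [div_le_one hq0]⟩
      (by rw [div_mul_cancel₀ _ hq0.ne']) (Or.inr ⟨hq0, rfl⟩)
  have hsq := headRoot_sq hq hRB.le
  have h2 := two_mul_le_headRoot hq hRB.le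
  set k := headRoot q RB
  have hk : 0 < k := by linarith
  have hv : RA / (q + k / 2) * (1 - RB / k) = RA / (q + k) := by
    have : RB = k ^ 2 / (2 * (k + q)) := by rw [hsq]; field_simp
    rw [this]
    field_simp
    ring
  rw [← hv]
  have e1 : k / (q + k) / k * q = q / (q + k) := by field_simp
  have e2 : 1 - k / (q + k) - q / (q + k) = 0 := by field_simp; ring
  refine hasLottoValue_of_headStart_B (bB := k / (q + k)) hq hk hRA.le hRB.le
    ⟨by positivity, ?_⟩ ⟨by positivity, ?_⟩ ?_ ?_ ?_ ?_
  · rw [div_le_one (by positivity)]; linarith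
  · rw [div_le_one (by positivity)]; linarith
  · rw [div_mul_cancel₀ _ (by positivity)]
  · rw [div_mul_eq_mul_div, div_le_iff₀ (by positivity)]; nlinarith
  · rw [e1, e2]
  · rw [e1, e2, hv]; field_simp; ring

theorem hasLottoValue_uniform_A_of_headStart_B {q RA RB : ℝ} (hq : 0 ≤ q) (hRA : 0 < RA)
    (hRB : 0 ≤ RB) (h : q + headRoot q RB / 2 ≤ RA) :
    HasLottoValue (-q) RA RB (1 - RB / (2 * (RA - q))) := by
  have h2 := two_mul_le_headRoot hq hRB
  obtain ⟨y, hy⟩ : ∃ y, y = RA - q := ⟨_, rfl⟩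
  have hRy : RB ≤ y := by linarith
  have hRA' : RA = y + q := by linarith
  rw [← hy]
  rcases hRB.eq_or_lt with rfl | hRB
  · rw [zero_div, sub_zero]
    exact hasLottoValue_zero_budget hq hRA.le ⟨by simp, le_rfl⟩ (by linarith) (Or.inl rfl)
  have hy0 : 0 < y := by linarith
  have hqq : 2 * RB * (2 * y + q) ≤ (2 * y) ^ 2 := by
    have hsq := headRoot_sq hq hRB.le
    have : headRoot q RB ≤ 2 * y := by linarith
    nlinarith
  have hv : 1 - RB / (2 * y) = 1 * (1 - RB / (2 * y)) := by ring
  have e1 : 1 - RB / y - RB / y / (2 * y) * q =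
      ((2 * y) ^ 2 - 2 * RB * (2 * y + q)) / (2 * y) ^ 2 := by
    field_simp; ring
  rw [hv]
  refine hasLottoValue_of_headStart_B (bB := RB / y) hq (by positivity) hRA.le hRB.le
    ⟨by simp, le_rfl⟩ ⟨by positivity, ?_⟩ ?_ ?_ ?_ ?_
  · rwa [div_le_one hy0]
  · apply le_of_eq; linarith
  · apply le_of_eq; field_simp
  · rw [e1]; exact div_nonneg (by linarith) (by positivity)
  · rw [hRA']; field_simp; ring

theorem exists_hasLottoValue (p : ℝ) {RA RB : ℝ} (hRA : 0 < RA) (hRB : 0 ≤ RB) :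
    ∃ v, HasLottoValue p RA RB v := by
  rcases le_total 0 p with hp | hp
  · rcases le_total RB (p + headRoot p RA / 2) with h | h
    · exact ⟨_, hasLottoValue_uniform_A hp hRA hRB h⟩
    · exact ⟨_, hasLottoValue_uniform_B hp hRA h⟩
  · obtain ⟨q, rfl⟩ : ∃ q, p = -q := ⟨-p, by simp⟩
    have hq : 0 ≤ q := by linarith
    rcases le_total RA (q + headRoot q RB / 2) with h | h
    · exact ⟨_, hasLottoValue_uniform_B_of_headStart_B hq hRA hRB h⟩
    · exact ⟨_, hasLottoValue_uniform_A_of_headStart_B hq hRA hRB h⟩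

theorem HasLottoValue.unique {p RA RB v w : ℝ} (hv : HasLottoValue p RA RB v)
    (hw : HasLottoValue p RA RB w) : v = w :=
  hv.eqPayoff_eq.symm.trans hw.eqPayoff_eq

/-- The width `k` is free, so `A` may use a width that is not optimal; this is how values at
different head starts are compared. -/
theorem HasLottoValue.guarantee_le {q RA RB v k : ℝ} (hq : 0 ≤ q) (hRA : 0 < RA) (hRB : 0 ≤ RB)
    (hv : HasLottoValue (-q) RA RB v) (hk : 0 < k) (h : RA ≤ q + k / 2) :
    RA / (q + k / 2) * (1 - RB / k) ≤ v := by
  have hb : RA / (q + k / 2) ∈ Icc (0 : ℝ) 1 :=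
    ⟨by positivity, by rw [div_le_one (by positivity)]; exact h⟩
  refine hv.le_of_forall (FA := lottoMix _ q k hb) (lottoMix_mem hb hq hk.le ?_)
    fun FB hFB => le_payoff_lottoMix_of_headStart_B hk hRB hb hFB
  rw [div_mul_cancel₀ _ (by positivity)]

/-! ### Monotonicity in the pre-allocation of `B` -/

section HeadStartA

variable {p d c RA RB v w : ℝ}

/-- With `h` and `g` the roots for `p + d` and `p`, subtracting their quadratic equations gives `(d
+ h - g) * (h + g - 2 * RA) = d * (h + g)`. The claim then reduces to `RA ^ 2 ≤ (h - RA) * (g -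
RA)`, true because both roots are at least `2 * RA`. -/
theorem headRoot_increment_le (hp : 0 ≤ p) (hd : 0 < d) (hRA : 0 < RA) :
    (RA + (p + d)) * (d + headRoot (p + d) RA - headRoot p RA) ≤
      d * (p + d + headRoot (p + d) RA) := by
  have hpd : 0 ≤ p + d := by linarith
  have e1 := headRoot_sq hpd hRA.le
  have e2 := headRoot_sq hp hRA.le
  have l1 := two_mul_le_headRoot hpd hRA.le
  have l2 := two_mul_le_headRoot hp hRA.le
  set h := headRoot (p + d) RA
  set g := headRoot p RA
  have hS : 0 < h + g - 2 * RA := by linarith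
  have e3 : (d + h - g) * (h + g - 2 * RA) = d * (h + g) := by linarith
  refine le_of_mul_le_mul_right ?_ hS
  rw [mul_assoc, e3]
  have e4 : (h - RA) * (h + g) - h ^ 2 = (h - RA) * (g - RA) - RA ^ 2 := by ring
  have e5 : RA * RA ≤ (h - RA) * (g - RA) :=
    mul_le_mul (by linarith) (by linarith) hRA.le (by linarith)
  have e6 : (RA + (p + d)) * (h + g) ≤ (p + d + h) * (h + g - 2 * RA) := by nlinarith
  nlinarith

theorem HasLottoValue.le_of_headStart_A (hp : 0 ≤ p) (hd : 0 < d) (hc0 : 0 < c) (hc1 : c < 1)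
    (hRA : 0 < RA) (hRB : 0 ≤ RB - c * d) (h : RB ≤ c * (RA + (p + d)))
    (hv : HasLottoValue (p + d) RA RB v) (hw : HasLottoValue p RA (RB - c * d) w) :
    v ≤ w ∧ (RB < c * (RA + (p + d)) → v < w) := by
  have hpd : 0 ≤ p + d := by linarith
  have hcd : 0 < c * d := mul_pos hc0 hd
  have l1 := two_mul_le_headRoot hpd hRA.le
  have l2 := two_mul_le_headRoot hp hRA.le
  have hcle : c * (RA + (p + d)) ≤ RA + (p + d) :=
    mul_le_of_le_one_left (by linarith) hc1.le
  have hcd' : c * (RA + (p + d)) - c * d ≤ RA + p := by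
    have : c * (RA + p) ≤ RA + p := mul_le_of_le_one_left (by linarith) hc1.le
    linarith
  have hv' := hasLottoValue_uniform_A hpd hRA (RB := RB) (by linarith) (by linarith)
  have hw' := hasLottoValue_uniform_A hp hRA hRB (by linarith)
  have key := headRoot_increment_le hp hd hRA
  rw [hv.unique hv', hw.unique hw']
  have hpos : 0 < d + headRoot (p + d) RA - headRoot p RA := by
    have e1 := headRoot_sq hpd hRA.le
    have e2 := headRoot_sq hp hRA.le
    by_contra! hcon
    nlinarith [mul_pos hRA hd]
  set a := headRoot (p + d) RA
  set b := headRoot p RA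
  -- This is `v ≤ w` after clearing denominators in the closed forms.
  have hmono : RB * (d + a - b) ≤ c * d * (p + d + a) := by
    calc RB * (d + a - b) ≤ c * (RA + (p + d)) * (d + a - b) := by gcongr
      _ = c * ((RA + (p + d)) * (d + a - b)) := by ring
      _ ≤ c * (d * (p + d + a)) := by gcongr
      _ = _ := by ring
  constructor
  · apply sub_le_sub_left
    rw [div_le_div_iff₀ (by linarith) (by linarith)]
    linarith
  · intro hlt
    have hmono' : RB * (d + a - b) < c * d * (p + d + a) := by
      calc RB * (d + a - b) < c * (RA + (p + d)) * (d + a - b) := by gcongr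
        _ = c * ((RA + (p + d)) * (d + a - b)) := by ring
        _ ≤ c * (d * (p + d + a)) := by gcongr
        _ = _ := by ring
    apply sub_lt_sub_left
    rw [div_lt_div_iff₀ (by linarith) (by linarith)]
    linarith

end HeadStartA

section HeadStartB

variable {q d c RA RB v w : ℝ}

/-- The value `v` is explicit, while `w` is only bounded below by a guarantee of `A`: the old width
is kept if `A` sometimes bids `0` at head start `q`, and otherwise the width is the one that spends
`RA` while always bidding at least `q + d`. -/
theorem HasLottoValue.le_of_headStart_B (hq : 0 ≤ q) (hd : 0 < d) (hc0 : 0 < c)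
    (hRA : 0 < RA) (hRB : 0 ≤ RB - c * d) (h : RB ≤ c * (RA - q))
    (hv : HasLottoValue (-q) RA RB v) (hw : HasLottoValue (-(q + d)) RA (RB - c * d) w) :
    v ≤ w ∧ (RB < c * (RA - q) → v < w) := by
  have hqd : 0 ≤ q + d := by linarith
  have hcd : 0 < c * d := mul_pos hc0 hd
  have hRB0 : 0 < RB := by linarith
  have l1 := two_mul_le_headRoot hq hRB0.le
  have e1 := headRoot_sq hq hRB0.le
  rcases le_total RA (q + headRoot q RB / 2) with hr | hr
  · rw [hv.unique (hasLottoValue_uniform_B_of_headStart_B hq hRA hRB0.le hr)]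
    have hk : 0 < headRoot q RB := by linarith
    have hg := hw.guarantee_le hqd hRA hRB hk (by linarith)
    set k := headRoot q RB
    have hdiff : RA / (q + d + k / 2) * (1 - (RB - c * d) / k) - RA / (q + k) =
        RA * d * (c * (q + k) - k) / ((q + d + k / 2) * k * (q + k)) := by
      have : RB = k ^ 2 / (2 * (k + q)) := by rw [e1]; field_simp
      rw [this]
      field_simp
      ring
    have hden : 0 < (q + d + k / 2) * k * (q + k) := by positivity
    have hkw : k * k = 2 * RB * (q + k) := by linarith
    constructor
    · have hck : k ≤ c * (q + k) := by
        refine le_of_mul_le_mul_left ?_ hk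
        calc k * k = 2 * RB * (q + k) := hkw
          _ ≤ 2 * (c * (RA - q)) * (q + k) := by gcongr
          _ ≤ 2 * (c * (k / 2)) * (q + k) := by gcongr; linarith
          _ = _ := by ring
      have : 0 ≤ RA * d * (c * (q + k) - k) / ((q + d + k / 2) * k * (q + k)) :=
        div_nonneg (mul_nonneg (by positivity) (by linarith)) hden.le
      linarith
    · intro hlt
      have hck : k < c * (q + k) := by
        refine lt_of_mul_lt_mul_left ?_ hk.le
        calc k * k = 2 * RB * (q + k) := hkw
          _ < 2 * (c * (RA - q)) * (q + k) := by gcongr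
          _ ≤ 2 * (c * (k / 2)) * (q + k) := by gcongr; linarith
          _ = _ := by ring
      have : 0 < RA * d * (c * (q + k) - k) / ((q + d + k / 2) * k * (q + k)) :=
        div_pos (mul_pos (by positivity) (by linarith)) hden
      linarith
  · rw [hv.unique (hasLottoValue_uniform_A_of_headStart_B hq hRA hRB0.le hr)]
    have ht : c * d ≤ c * (RA - q) := by linarith
    have ht' : d ≤ RA - q := le_of_mul_le_mul_left ht hc0
    rcases ht'.eq_or_lt with he | hlt
    -- The width would be zero; but then `B` has spent everything and `A` wins surely by bidding `q
    -- + d = RA`.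
    · have hz : RB - c * d = 0 := by rw [he] at hRB ⊢; linarith
      rw [hz] at hw
      have h1 := hw.unique (hasLottoValue_zero_budget (b := 1) hqd hRA.le ⟨by simp, le_rfl⟩
        (by linarith) (Or.inl rfl))
      have : 0 < RB / (2 * (RA - q)) := div_pos hRB0 (by linarith)
      rw [h1]
      exact ⟨by linarith, fun _ => by linarith⟩
    · have hg := hw.guarantee_le hqd hRA hRB (k := 2 * (RA - (q + d))) (by linarith)
        (by linarith)
      have e : q + d + 2 * (RA - (q + d)) / 2 = RA := by ring
      rw [e, div_self hRA.ne', one_mul] at hg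
      refine ⟨le_trans ?_ hg, fun hs => lt_of_lt_of_le ?_ hg⟩
      · apply sub_le_sub_left
        rw [div_le_div_iff₀ (by linarith) (by linarith)]
        nlinarith
      · apply sub_lt_sub_left
        rw [div_lt_div_iff₀ (by linarith) (by linarith)]
        nlinarith

end HeadStartB

theorem stackPayoffB_eq {MA cA MB cB pA pB v : ℝ}
    (h : HasLottoValue (pA - pB) (MA - cA * pA) (MB - cB * pB) v) :
    stackPayoffB MA cA MB cB pA pB = 1 - v := by
  rw [stackPayoffB, stackPayoffA, h.eqPayoff_eq]

theorem stackPayoffB_monotonicity {MA cA MB cB pA RA x y : ℝ} (hcB : cB ∈ Ioo (0 : ℝ) 1)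
    (hRA : RA = MA - cA * pA) (hRA_pos : 0 < RA) (h : MB ≤ cB * (RA + pA)) (hxy : x < y)
    (hy : 0 ≤ MB - cB * y) :
    stackPayoffB MA cA MB cB pA y ≤ stackPayoffB MA cA MB cB pA x ∧
      (MB < cB * (RA + pA) →
        stackPayoffB MA cA MB cB pA y < stackPayoffB MA cA MB cB pA x) := by
  have hpos : ∀ z ≤ y, 0 ≤ MB - cB * z := fun z hz => by
    have := mul_le_mul_of_nonneg_left hz hcB.1.le
    linarith
  have left : ∀ a b, a < b → b ≤ pA → b ≤ y →
      stackPayoffB MA cA MB cB pA b ≤ stackPayoffB MA cA MB cB pA a ∧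
      (MB < cB * (RA + pA) →
        stackPayoffB MA cA MB cB pA b < stackPayoffB MA cA MB cB pA a) := by
    intro a b hab hb hby
    obtain ⟨v, hv⟩ := exists_hasLottoValue (pA - a) hRA_pos (hpos a (hab.le.trans hby))
    obtain ⟨w, hw⟩ := exists_hasLottoValue (pA - b) hRA_pos (hpos b hby)
    rw [stackPayoffB_eq (hRA ▸ hw), stackPayoffB_eq (hRA ▸ hv)]
    have e1 : pA - a = pA - b + (b - a) := by ring
    have e2 : MB - cB * b = MB - cB * a - cB * (b - a) := by ring
    rw [e1] at hv
    rw [e2] at hw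
    obtain ⟨h1, h2⟩ := HasLottoValue.le_of_headStart_A (sub_nonneg.2 hb) (sub_pos.2 hab) hcB.1
      hcB.2 hRA_pos (e2 ▸ hpos b hby) (by linarith) hv hw
    exact ⟨by linarith, fun hs => by linarith [h2 (by linarith)]⟩
  have right : ∀ a b, a < b → pA ≤ a → b ≤ y →
      stackPayoffB MA cA MB cB pA b ≤ stackPayoffB MA cA MB cB pA a ∧
      (MB < cB * (RA + pA) →
        stackPayoffB MA cA MB cB pA b < stackPayoffB MA cA MB cB pA a) := by
    intro a b hab ha hby
    obtain ⟨v, hv⟩ := exists_hasLottoValue (pA - a) hRA_pos (hpos a (hab.le.trans hby))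
    obtain ⟨w, hw⟩ := exists_hasLottoValue (pA - b) hRA_pos (hpos b hby)
    rw [stackPayoffB_eq (hRA ▸ hw), stackPayoffB_eq (hRA ▸ hv)]
    have e1 : pA - b = -(a - pA + (b - a)) := by ring
    have e2 : MB - cB * b = MB - cB * a - cB * (b - a) := by ring
    have e3 : pA - a = -(a - pA) := by ring
    rw [e3] at hv
    rw [e1, e2] at hw
    obtain ⟨h1, h2⟩ := HasLottoValue.le_of_headStart_B (sub_nonneg.2 ha) (sub_pos.2 hab) hcB.1
      hRA_pos (e2 ▸ hpos b hby) (by linarith) hv hw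
    exact ⟨by linarith, fun hs => by linarith [h2 (by linarith)]⟩
  rcases le_total y pA with hyA | hyA
  · exact left x y hxy hyA le_rfl
  · rcases le_or_gt pA x with hxA | hxA
    · exact right x y hxy hxA le_rfl
    · rcases hyA.eq_or_lt with rfl | hyA
      · exact left x _ hxy le_rfl le_rfl
      · obtain ⟨l1, l2⟩ := left x pA hxA le_rfl hyA.le
        obtain ⟨r1, r2⟩ := right pA y hyA le_rfl le_rfl
        exact ⟨r1.trans l1, fun hs => (r2 hs).trans (l2 hs)⟩

/-! ### Identification with the stated formulas -/

section Formulas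

variable {MA cA MB cB pA pB RA : ℝ}

theorem stackPayoffB_eq_uB1A (hRA : RA = MA - cA * pA) (hRA_pos : 0 < RA)
    (hRB : 0 ≤ MB - cB * pB) (hp : pB ≤ pA)
    (h : MB - cB * pB ≤ pA - pB + headRoot (pA - pB) RA / 2) :
    stackPayoffB MA cA MB cB pA pB = uB1A RA MB cB pA pB := by
  have hp' := sub_nonneg.2 hp
  rw [stackPayoffB_eq (hRA ▸ hasLottoValue_uniform_A hp' hRA_pos hRB h)]
  have hsq := headRoot_sq hp' hRA_pos.le
  have h2 := two_mul_le_headRoot hp' hRA_pos.le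
  have hf : fA RA pA pB = headRoot (pA - pB) RA := rfl
  rw [uB1A, hf, ← hRA]
  set k := headRoot (pA - pB) RA
  have hk : 0 < k := by linarith
  -- The equation `k ^ 2 = 2 * RA * (k + p)`, with `p = pA - pB`, collapses the squared fraction to
  -- `RB / (p + k)`.
  rw [div_pow, hsq]
  field_simp
  ring

theorem stackPayoffB_eq_uB2A (hRA : RA = MA - cA * pA) (hRA_pos : 0 < RA) (hp : pB ≤ pA)
    (h : pA - pB + headRoot (pA - pB) RA / 2 ≤ MB - cB * pB) :
    stackPayoffB MA cA MB cB pA pB = uB2A RA MB cB pA pB := by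
  rw [stackPayoffB_eq (hRA ▸ hasLottoValue_uniform_B (sub_nonneg.2 hp) hRA_pos h), uB2A, hRA]

theorem stackPayoffB_eq_uB1B (hRA : RA = MA - cA * pA) (hRA_pos : 0 < RA)
    (hRB : 0 ≤ MB - cB * pB) (hp : pA < pB)
    (h : RA ≤ pB - pA + headRoot (pB - pA) (MB - cB * pB) / 2) :
    stackPayoffB MA cA MB cB pA pB = uB1B RA MB cB pA pB := by
  have hq := sub_pos.2 hp
  have hv := hasLottoValue_uniform_B_of_headStart_B hq.le hRA_pos hRB h
  rw [neg_sub, hRA] at hv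
  rw [stackPayoffB_eq hv, ← hRA, uB1B]
  have h2 := two_mul_le_headRoot hq.le hRB
  have hfg : fB MB cB pB * gB MB cB pA pB =
      √((MB - cB * pB) * (MB - cB * pB + 2 * (pB - pA))) := by
    rw [fB, gB, Real.sqrt_mul hRB]
  have hff : fB MB cB pB ^ 2 = MB - cB * pB := Real.sq_sqrt hRB
  have hgg : gB MB cB pA pB ^ 2 = MB - cB * pB + 2 * (pB - pA) :=
    Real.sq_sqrt (by positivity)
  have e1 : fB MB cB pB * (fB MB cB pB + gB MB cB pA pB) =
      headRoot (pB - pA) (MB - cB * pB) := by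
    rw [mul_add, hfg, ← sq, hff, headRoot]
  have e2 : (fB MB cB pB + gB MB cB pA pB) ^ 2 =
      2 * (pB - pA + headRoot (pB - pA) (MB - cB * pB)) := by
    rw [← e1]; linarith
  rw [div_pow, e2, e1]
  have : 0 < pB - pA + headRoot (pB - pA) (MB - cB * pB) := by linarith
  field_simp

theorem stackPayoffB_eq_uB2B (hRA : RA = MA - cA * pA) (hRA_pos : 0 < RA)
    (hRB : 0 ≤ MB - cB * pB) (hp : pA ≤ pB)
    (h : pB - pA + headRoot (pB - pA) (MB - cB * pB) / 2 ≤ RA) :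
    stackPayoffB MA cA MB cB pA pB = uB2B RA MB cB pA pB := by
  have hv := hasLottoValue_uniform_A_of_headStart_B (sub_nonneg.2 hp) hRA_pos hRB h
  rw [neg_sub, hRA] at hv
  rw [stackPayoffB_eq hv, uB2B, hRA]
  ring

end Formulas

/-! ### The breakpoints -/

section BreakF

variable {MB cB pA RA q : ℝ}

theorem existsUnique_breakF (hcB : 0 < cB) (hRA : 0 < RA) (h1 : cB * (RA + pA) < MB)
    (h2 : MB ≤ RA + cB * pA) :
    ∃ q, IsUniqueSolOn (Ico pA (RA + pA)) (fun pB => breakF RA pA pB = MB - cB * pB) q := by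
  have hden : ∀ x ∈ Icc pA (RA + pA), 2 * RA + pA - x ≠ 0 := fun x hx => by
    have := hx.2; intro h; linarith
  have hcont : ContinuousOn (fun x => breakF RA pA x - (MB - cB * x)) (Icc pA (RA + pA)) := by
    refine ContinuousOn.sub ?_ (by fun_prop)
    exact ContinuousOn.div (by fun_prop) (by fun_prop) hden
  have hab : pA ≤ RA + pA := by linarith
  have hl : breakF RA pA pA = RA := by
    rw [breakF]; field_simp; ring
  have hr : breakF RA pA (RA + pA) = 0 := by
    rw [breakF]; simp
  obtain ⟨q, hq, hq0⟩ := intermediate_value_Icc' hab hcont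
    (show (0 : ℝ) ∈ Icc _ _ from ⟨by simp only [hr]; linarith, by simp only [hl]; linarith⟩)
  have hq0' : breakF RA pA q = MB - cB * q := sub_eq_zero.1 hq0
  have hqlt : ∀ x ∈ Icc pA (RA + pA), breakF RA pA x = MB - cB * x → x < RA + pA := by
    intro x hx h
    refine lt_of_le_of_ne hx.2 ?_
    rintro rfl
    rw [hr] at h
    linarith
  have mono : ∀ x ∈ Ico pA (RA + pA), ∀ y ∈ Ico pA (RA + pA), x < y →
      breakF RA pA x = MB - cB * x → breakF RA pA y = MB - cB * y → False := by
    intro x hx y hy hxy ex ey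
    have hx2 := hx.2
    have hy2 := hy.2
    rw [breakF, div_eq_iff (hden x (Ico_subset_Icc_self hx))] at ex
    rw [breakF, div_eq_iff (hden y (Ico_subset_Icc_self hy))] at ey
    -- In the distance `t` to `RA + pA`, a solution satisfies `2 * t ^ 2 = (cB * t + e) * (RA + t)`.
    -- Divided by `t ^ 2`, the right side is strictly decreasing in `t > 0`, so two solutions cannot
    -- coexist; the products below avoid the division.
    obtain ⟨t, rfl⟩ : ∃ t, y = RA + pA - t := ⟨RA + pA - y, by ring⟩
    obtain ⟨s, rfl⟩ : ∃ s, x = RA + pA - s := ⟨RA + pA - x, by ring⟩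
    obtain ⟨e, rfl⟩ : ∃ e, MB = cB * (RA + pA) + e := ⟨MB - cB * (RA + pA), by ring⟩
    have he : 0 < e := by linarith
    have ht : 0 < t := by linarith
    have hts : t < s := by linarith
    have hs : 0 < s := ht.trans hts
    have ex' : 2 * s ^ 2 = (cB * s + e) * (RA + s) := by linarith
    have ey' : 2 * t ^ 2 = (cB * t + e) * (RA + t) := by linarith
    have g1 : s * (cB * t + e) > t * (cB * s + e) := by nlinarith
    have g2 : s * (RA + t) > t * (RA + s) := by nlinarith
    have g3 : (s * (cB * t + e)) * (s * (RA + t)) > (t * (cB * s + e)) * (t * (RA + s)) :=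
      mul_lt_mul g1 g2.le (by positivity) (by positivity)
    have g4 : (s * (cB * t + e)) * (s * (RA + t)) = s ^ 2 * (2 * t ^ 2) := by rw [ey']; ring
    have g5 : (t * (cB * s + e)) * (t * (RA + s)) = t ^ 2 * (2 * s ^ 2) := by rw [ex']; ring
    rw [g4, g5] at g3
    linarith
  have hqI : q ∈ Ico pA (RA + pA) := ⟨hq.1, hqlt q hq hq0'⟩
  refine ⟨q, hqI, hq0', fun x hx ex => ?_⟩
  rcases lt_trichotomy x q with h | h | h
  · exact (mono x hx q hqI h ex hq0').elim
  · exact h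
  · exact (mono q hqI x hx h hq0' ex).elim

/-- A violation at `x ≤ q` would, by the intermediate value theorem from `pA`, produce a solution in
`[pA, x]`. Uniqueness makes it `q`, so `x = q`, where equality holds. -/
theorem IsUniqueSolOn.forall_le_breakF (hRA : 0 < RA) (h2 : MB ≤ RA + cB * pA)
    (hq : IsUniqueSolOn (Ico pA (RA + pA)) (fun pB => breakF RA pA pB = MB - cB * pB) q) :
    ∀ x ∈ Icc pA q, MB - cB * x ≤ breakF RA pA x := by
  intro x hx
  by_contra! hlt
  have hq2 := hq.1.2
  have hcont : ContinuousOn (fun x => breakF RA pA x - (MB - cB * x)) (Icc pA x) := by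
    refine ContinuousOn.sub ?_ (by fun_prop)
    refine ContinuousOn.div (by fun_prop) (by fun_prop) fun y hy h => ?_
    linarith [hy.2, hx.2]
  have hl : breakF RA pA pA = RA := by
    rw [breakF]; field_simp; ring
  obtain ⟨z, hz, hz0⟩ := intermediate_value_Icc' hx.1 hcont
    (show (0 : ℝ) ∈ Icc _ _ from ⟨by linarith, by simp only [hl]; linarith⟩)
  have hz0' : breakF RA pA z = MB - cB * z := sub_eq_zero.1 hz0
  have hzq := hq.2.2 z ⟨hz.1, by linarith [hz.2, hx.2]⟩ hz0'
  have hxq : x = q := le_antisymm hx.2 (hzq ▸ hz.2)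
  rw [hxq, hq.2.1] at hlt
  exact lt_irrefl _ hlt

theorem IsUniqueSolOn.forall_breakF_le (hRA : 0 < RA) (h1 : cB * (RA + pA) < MB)
    (hq : IsUniqueSolOn (Ico pA (RA + pA)) (fun pB => breakF RA pA pB = MB - cB * pB) q) :
    ∀ x ∈ Icc q (RA + pA), breakF RA pA x ≤ MB - cB * x := by
  intro x hx
  by_contra! hlt
  have hcont : ContinuousOn (fun x => breakF RA pA x - (MB - cB * x)) (Icc x (RA + pA)) := by
    refine ContinuousOn.sub ?_ (by fun_prop)
    refine ContinuousOn.div (by fun_prop) (by fun_prop) fun y hy h => ?_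
    linarith [hy.2]
  have hr : breakF RA pA (RA + pA) = 0 := by
    rw [breakF]; simp
  obtain ⟨z, hz, hz0⟩ := intermediate_value_Icc' hx.2 hcont
    (show (0 : ℝ) ∈ Icc _ _ from ⟨by simp only [hr]; linarith, by linarith⟩)
  have hz0' : breakF RA pA z = MB - cB * z := sub_eq_zero.1 hz0
  have hzne : z ≠ RA + pA := by
    rintro rfl
    rw [hr] at hz0'
    linarith
  have hzq := hq.2.2 z ⟨hq.1.1.trans (hx.1.trans hz.1), lt_of_le_of_ne hz.2 hzne⟩ hz0'
  have hxq : x = q := le_antisymm (hzq ▸ hz.1) hx.1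
  rw [hxq, hq.2.1] at hlt
  exact lt_irrefl _ hlt

end BreakF

section BreakG

variable {MB cB pA pB RA : ℝ}

theorem headRoot_mono {p p' R : ℝ} (hR : 0 ≤ R) (h : p ≤ p') : headRoot p R ≤ headRoot p' R := by
  rw [headRoot, headRoot]
  gcongr

/-- With `y = RB - p`, the equation says that `2 * y` is a root of `h ^ 2 = 2 * RA * (h + p)`. The
other root, `2 * RA - headRoot p RA`, is negative for `p > 0`; the restriction `y ≥ 0` rules it out.
-/
theorem breakG_eq_iff (hRA : 0 < RA) (hp : pB < pA) (hy : pA - pB ≤ MB - cB * pB) :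
    breakG MB cB pA pB = RA ↔ MB - cB * pB - (pA - pB) = headRoot (pA - pB) RA / 2 := by
  obtain ⟨p, hp'⟩ : ∃ p, p = pA - pB := ⟨_, rfl⟩
  obtain ⟨y, hy'⟩ : ∃ y, y = MB - cB * pB - (pA - pB) := ⟨_, rfl⟩
  have hp0 : 0 < p := by linarith
  have hy0 : 0 ≤ y := by linarith
  have e1 : MB + (1 - cB) * pB - pA = y := by rw [hy']; ring
  have e2 : 2 * (MB - cB * pB) - (pA - pB) = 2 * y + p := by rw [hy', hp']; ring
  rw [breakG, e1, e2, ← hy', ← hp', div_eq_iff (by positivity)]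
  have hsq := headRoot_sq hp0.le hRA.le
  have h2 := two_mul_le_headRoot hp0.le hRA.le
  have hfac : 4 * y ^ 2 - 2 * RA * (2 * y + p) =
      (2 * y - headRoot p RA) * (2 * y + headRoot p RA - 2 * RA) := by linarith
  constructor
  · intro h
    have h0 : (2 * y - headRoot p RA) * (2 * y + headRoot p RA - 2 * RA) = 0 := by
      rw [← hfac]; linarith
    rcases mul_eq_zero.1 h0 with h | h
    · linarith
    · have hy00 : y = 0 := by linarith
      subst hy00
      nlinarith [mul_pos hRA hp0]
  · intro h
    have h0 : 2 * y - headRoot p RA = 0 := by linarith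
    rw [h0, zero_mul] at hfac
    linarith

/-- The linear part has slope `1 - cB > 0` and `headRoot` grows with the head start. Hence `B`
crosses the regime boundary on the left of `pA` at most once. -/
theorem strictMono_excess (hcB : cB < 1) (hRA : 0 < RA) :
    StrictMono fun x => MB - cB * x - (pA - x) - headRoot (pA - x) RA / 2 := by
  intro x y hxy
  have h1 := headRoot_mono hRA.le (by linarith : pA - y ≤ pA - x)
  have h2 : 0 < (1 - cB) * (y - x) := mul_pos (by linarith) (by linarith)
  change _ < _
  simp only
  linarith

theorem headRoot_zero {R : ℝ} (hR : 0 ≤ R) : headRoot 0 R = 2 * R := by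
  rw [headRoot, mul_zero, add_zero, Real.sqrt_mul_self hR]
  ring

theorem exists_breakG (hcB1 : cB < 1) (hRA : 0 < RA) (hpA : 0 ≤ pA)
    (h1 : RA + cB * pA < MB) (h2 : MB ≤ pA + headRoot pA RA / 2) :
    ∃ q, IsUniqueSolOn {pB | pB ∈ Ico 0 pA ∧ pA - pB ≤ MB - cB * pB}
        (fun pB => breakG MB cB pA pB = RA) q ∧
      MB - cB * q - (pA - q) = headRoot (pA - q) RA / 2 := by
  have hsm := strictMono_excess (MB := MB) (pA := pA) hcB1 hRA
  have hcont : ContinuousOn (fun x => MB - cB * x - (pA - x) - headRoot (pA - x) RA / 2)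
      (Icc 0 pA) := by
    simp only [headRoot]
    fun_prop
  have h0 : 0 < MB - cB * pA - (pA - pA) - headRoot (pA - pA) RA / 2 := by
    rw [sub_self, headRoot_zero hRA.le]; linarith
  obtain ⟨q, hq, hq0⟩ := intermediate_value_Icc hpA hcont
    (show (0 : ℝ) ∈ Icc _ _ from ⟨by simp only [sub_zero, mul_zero]; linarith, h0.le⟩)
  simp only at hq0
  have hqlt : q < pA := by
    refine lt_of_le_of_ne hq.2 ?_
    rintro rfl
    linarith
  have hq' := sub_eq_zero.1 hq0
  have h2 := two_mul_le_headRoot (sub_nonneg.2 hqlt.le) hRA.le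
  have hqy : pA - q ≤ MB - cB * q := by linarith
  refine ⟨q, ⟨⟨⟨hq.1, hqlt⟩, hqy⟩, (breakG_eq_iff hRA hqlt hqy).2 hq', ?_⟩, hq'⟩
  rintro x ⟨hx, hxy⟩ ex
  refine hsm.injective ?_
  rw [hq0, (breakG_eq_iff hRA hx.2 hxy).1 ex, sub_self]

end BreakG

/-- Clearing the denominator gives the quadratic test that compares `2 * (RA - q)` with `headRoot q
R`, where `q = x - pA`. -/
theorem breakF_le_iff {RA pA x R : ℝ} (hRA : 0 < RA) (hx : x ≤ RA + pA) :
    breakF RA pA x ≤ R ↔ (2 * (RA - (x - pA))) ^ 2 ≤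
      2 * R * (2 * (RA - (x - pA)) + (x - pA)) := by
  rw [breakF, div_le_iff₀ (by linarith)]
  constructor <;> intro <;> linarith

theorem le_breakF_iff {RA pA x R : ℝ} (hRA : 0 < RA) (hx : x ≤ RA + pA) :
    R ≤ breakF RA pA x ↔ 2 * R * (2 * (RA - (x - pA)) + (x - pA)) ≤
      (2 * (RA - (x - pA))) ^ 2 := by
  rw [breakF, le_div_iff₀ (by linarith)]
  constructor <;> intro <;> linarith

theorem headRoot_le_of_sq {p R x : ℝ} (hp : 0 ≤ p) (hR : 0 ≤ R) (hx : 0 < x)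
    (h : 2 * R * (x + p) ≤ x ^ 2) : headRoot p R ≤ x := by
  have h2R : 2 * R ≤ x := by
    refine le_of_mul_le_mul_right ?_ hx
    nlinarith [mul_nonneg hR hp]
  rw [headRoot, ← le_sub_iff_add_le', Real.sqrt_le_iff]
  exact ⟨by linarith, by nlinarith⟩

/-! ### The lemma -/

theorem mainTheorem7 (MA cA MB cB pA RA : ℝ)
    (hcA : cA ∈ Ioo (0 : ℝ) 1) (hcB : cB ∈ Ioo (0 : ℝ) 1) (hMB : 0 ≤ MB)
    (hpA : pA ∈ Icc 0 (MA / cA)) (hRA : RA = MA - cA * pA) (hRA_pos : 0 < RA) :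
    -- the equilibrium payoff of the final stage is well defined for every response of `B`
    (∀ pB ∈ Icc 0 (MB / cB), ∃ v, lottoNashPayoffsA (pA - pB) RA (MB - cB * pB) = {v}) ∧
    -- a)
    (MB / cB ≤ RA + pA →
      AntitoneOn (fun pB => stackPayoffB MA cA MB cB pA pB) (Icc 0 (MB / cB))) ∧
    (MB / cB < RA + pA →
      StrictAntiOn (fun pB => stackPayoffB MA cA MB cB pA pB) (Icc 0 (MB / cB))) ∧
    -- b)
    (RA + pA < MB / cB → MB / cB ≤ RA / cB + pA →
      ∃ p1B, IsUniqueSolOn (Ico pA (RA + pA)) (fun pB => breakF RA pA pB = MB - cB * pB) p1B ∧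
        (∀ pB ∈ Icc 0 pA, stackPayoffB MA cA MB cB pA pB = uB1A RA MB cB pA pB) ∧
        (∀ pB ∈ Ioc pA p1B, stackPayoffB MA cA MB cB pA pB = uB2B RA MB cB pA pB) ∧
        (∀ pB ∈ Ioc p1B (MB / cB), stackPayoffB MA cA MB cB pA pB = uB1B RA MB cB pA pB)) ∧
    -- c)
    (RA / cB + pA < MB / cB →
      MB / cB ≤ 1 / cB * (pA + (RA + √(RA * (RA + 2 * pA))) / 2) →
      ∃ p1A, IsUniqueSolOn {pB | pB ∈ Ico 0 pA ∧ pA - pB ≤ MB - cB * pB}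
          (fun pB => breakG MB cB pA pB = RA) p1A ∧
        (∀ pB ∈ Icc 0 p1A, stackPayoffB MA cA MB cB pA pB = uB1A RA MB cB pA pB) ∧
        (∀ pB ∈ Ioc p1A pA, stackPayoffB MA cA MB cB pA pB = uB2A RA MB cB pA pB) ∧
        (∀ pB ∈ Ioc pA (MB / cB), stackPayoffB MA cA MB cB pA pB = uB1B RA MB cB pA pB)) ∧
    -- d)
    (1 / cB * (pA + (RA + √(RA * (RA + 2 * pA))) / 2) < MB / cB →
        (∀ pB ∈ Icc 0 pA, stackPayoffB MA cA MB cB pA pB = uB2A RA MB cB pA pB) ∧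
        (∀ pB ∈ Ioc pA (MB / cB),
          stackPayoffB MA cA MB cB pA pB = uB1B RA MB cB pA pB)) := by
  obtain ⟨hc0, hc1⟩ := hcB
  have hpA0 := hpA.1
  have hRB : ∀ x ≤ MB / cB, 0 ≤ MB - cB * x := fun x hx => by
    rw [le_div_iff₀ hc0] at hx; linarith
  have e1 : RA / cB + pA = (RA + cB * pA) / cB := by field_simp
  have e2 : 1 / cB * (pA + (RA + √(RA * (RA + 2 * pA))) / 2) =
      (pA + headRoot pA RA / 2) / cB := by rw [headRoot]; ring
  have hcpA : cB * pA ≤ pA := mul_le_of_le_one_left hpA0 hc1.le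
  have hmA : RA + cB * pA < MB → pA ≤ MB / cB := fun h => by
    rw [le_div_iff₀ hc0]; linarith
  -- beyond `pA`, player `B` exhausts the budget once `RA + cB * pA < MB`
  have late : RA + cB * pA < MB → ∀ pB ∈ Ioc pA (MB / cB),
      stackPayoffB MA cA MB cB pA pB = uB1B RA MB cB pA pB := by
    intro h x hx
    have hR := hRB x hx.2
    refine stackPayoffB_eq_uB1B hRA hRA_pos hR hx.1 ?_
    have hq : 0 < x - pA := sub_pos.2 hx.1
    rcases le_or_gt RA (x - pA) with ht | ht
    · linarith [two_mul_le_headRoot hq.le hR]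
    -- With `t = RA - (x - pA) > 0`, a budget of at least `t` already gives `(2 * t) ^ 2 ≤ 2 * RB *
    -- (2 * t + q)`, hence `2 * t ≤ headRoot q RB`.
    · have hle : RA - (x - pA) ≤ MB - cB * x := by
        have : cB * (x - pA) ≤ x - pA := mul_le_of_le_one_left hq.le hc1.le
        linarith
      have := (le_headRoot_iff hq.le hR (by linarith : 0 ≤ 2 * (RA - (x - pA)))).2
        (by nlinarith)
      linarith
  refine ⟨fun x hx => ?_, fun h x hx y hy hxy => ?_, fun h x hx y hy hxy => ?_, fun h1 h2 => ?_,
    fun h1 h2 => ?_, fun h => ?_⟩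
  · obtain ⟨v, hv⟩ := exists_hasLottoValue (pA - x) hRA_pos (hRB x hx.2)
    exact ⟨v, hv.nashPayoffs_eq⟩
  · rw [div_le_iff₀' hc0] at h
    rcases hxy.eq_or_lt with rfl | hlt
    · exact le_rfl
    · exact (stackPayoffB_monotonicity ⟨hc0, hc1⟩ hRA hRA_pos h hlt (hRB y hy.2)).1
  · rw [div_lt_iff₀' hc0] at h
    exact (stackPayoffB_monotonicity ⟨hc0, hc1⟩ hRA hRA_pos h.le hxy (hRB y hy.2)).2 h
  · have hm : pA ≤ MB / cB := by linarith
    rw [lt_div_iff₀' hc0] at h1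
    rw [e1, div_le_div_iff_of_pos_right hc0] at h2
    obtain ⟨q, hq⟩ := existsUnique_breakF hc0 hRA_pos h1 h2
    refine ⟨q, hq, fun x hx => ?_, fun x hx => ?_, fun x hx => ?_⟩
    · refine stackPayoffB_eq_uB1A hRA hRA_pos (hRB x (hx.2.trans hm)) hx.2 ?_
      have h3 := two_mul_le_headRoot (sub_nonneg.2 hx.2) hRA_pos.le
      have : cB * (pA - x) ≤ pA - x := mul_le_of_le_one_left (sub_nonneg.2 hx.2) hc1.le
      linarith
    · have hxlt : x < RA + pA := hx.2.trans_lt hq.1.2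
      have hR : 0 ≤ MB - cB * x := by nlinarith
      refine stackPayoffB_eq_uB2B hRA hRA_pos hR hx.1.le ?_
      have := (le_breakF_iff hRA_pos hxlt.le).1 (hq.forall_le_breakF hRA_pos h2 x ⟨hx.1.le, hx.2⟩)
      have := headRoot_le_of_sq (sub_nonneg.2 hx.1.le) hR (by linarith) this
      linarith
    · have hR := hRB x hx.2
      have hpx : pA < x := hq.1.1.trans_lt hx.1
      have hq0 := sub_pos.2 hpx
      refine stackPayoffB_eq_uB1B hRA hRA_pos hR hpx ?_
      rcases le_or_gt (RA + pA) x with hxl | hxl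
      · linarith [two_mul_le_headRoot hq0.le hR]
      · have := (breakF_le_iff hRA_pos hxl.le).1
          (hq.forall_breakF_le hRA_pos h1 x ⟨hx.1.le, hxl.le⟩)
        have := (le_headRoot_iff hq0.le hR (by linarith)).2 this
        linarith
  · rw [e1, div_lt_div_iff_of_pos_right hc0] at h1
    rw [e2, div_le_div_iff_of_pos_right hc0] at h2
    obtain ⟨q, hq, hq0⟩ := exists_breakG hc1 hRA_pos hpA0 h1 h2
    have hsm := strictMono_excess (MB := MB) (pA := pA) hc1 hRA_pos
    have hqA : q < pA := hq.1.1.2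
    refine ⟨q, hq, fun x hx => ?_, fun x hx => ?_, late h1⟩
    · have hxA := hx.2.trans hqA.le
      have := hsm.monotone hx.2
      exact stackPayoffB_eq_uB1A hRA hRA_pos (hRB x (hxA.trans (hmA h1))) hxA (by linarith)
    · have := hsm.monotone hx.1.le
      exact stackPayoffB_eq_uB2A hRA hRA_pos hx.2 (by linarith)
  · rw [e2, div_lt_div_iff_of_pos_right hc0] at h
    have hsm := strictMono_excess (MB := MB) (pA := pA) hc1 hRA_pos
    refine ⟨fun x hx => ?_, late ?_⟩
    · have := hsm.monotone hx.1
      simp only [sub_zero, mul_zero] at this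
      exact stackPayoffB_eq_uB2A hRA hRA_pos hx.2 (by linarith)
    · linarith [two_mul_le_headRoot hpA0 hRA_pos.le]
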